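/- Let $1\le j\le d$ be integers, and let $\mathcal K^d$ be the space of convex bodies (nonempty compact convex subsets) of $\mathbb R^d$ with the Hausdorff metric. Let ${\bf Val}_j$ be the space of functions $\varphi:\mathcal K^d\to\mathbb R$ that are continuous, translation invariant, homogeneous of degree $j$ (that is, $\varphi(cK)=c^j\varphi(K)$ for $c>0$), and valuations (that is, $\varphi(K\cup L)+\varphi(K\cap L)=\varphi(K)+\varphi(L)$ whenever $K,L,K\cup L\in\mathcal K^d$). For $x\in\mathbb R^d$ let $\overline x$ be the closed segment with endpoints $o$ and $x$, where $o$ is the origin. Let $X$ be a random vector in $\mathbb R^d$ with $\mathbb E\|X\|<\infty$, let $X_1,\dots,X_j$ be i.i.d. copies of $X$, let $\varphi\in{\bf Val}_j$, and put $$h(x_1,\dots,x_j)=\varphi(\overline x_1+\dots+\overline x_j),\qquad \theta=\mathbb E\,h(X_1,\dots,X_j),$$ $$h_1(x)=\mathbb E\,h(x,X_2,\dots,X_j)\quad(x\in\mathbb R^d),\qquad \zeta_1=\mathbb E\,(h_1(X_1)-\theta)^2\in[0,\infty],$$ where sums of sets are Minkowski sums. Suppose that the support of the distribution of $X$ contains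 $o$ and is not contained in a $(j-1)$-dimensional linear subspace of $\mathbb R^d$. Suppose further that $\varphi(K)\neq 0$ for all $K\in\mathcal K^d$ with $\dim K\ge j$. Then the expectations defining $\theta$ and $h_1(x)$, for every $x\in\mathbb R^d$, exist (the integrands are integrable), and $\zeta_1>0$. If moreover $\mathbb E\|X\|^2<\infty$, then $\zeta_1$ is also finite, so that it is a strictly positive real number. -/

import Mathlib

open MeasureTheory ProbabilityTheory
open scoped ENNReal Pointwise

noncomputable section

/-- Euclidean space `ℝ^d`. -/
abbrev Euc (d : ℕ) : Type := EuclideanSpace ℝ (Fin d)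

/-- The dimension of a convex body: the dimension of (the direction of) its affine hull. -/
def bodyDim {d : ℕ} (K : ConvexBody (Euc d)) : ℕ :=
  Module.finrank ℝ (vectorSpan ℝ (K : Set (Euc d)))

/-- `φ ∈ Val_j`: `φ` is a translation invariant, continuous (for the Hausdorff metric) real
valuation on the convex bodies of `ℝ^d`, positively homogeneous of degree `j`. -/
structure IsVal {d : ℕ} (j : ℕ) (φ : ConvexBody (Euc d) → ℝ) : Prop where
  valuation : ∀ K L U I : ConvexBody (Euc d),
    (U : Set (Euc d)) = (K : Set (Euc d)) ∪ (L : Set (Euc d)) →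
    (I : Set (Euc d)) = (K : Set (Euc d)) ∩ (L : Set (Euc d)) →
    φ U + φ I = φ K + φ L
  translation_invariant : ∀ (K L : ConvexBody (Euc d)) (t : Euc d),
    (L : Set (Euc d)) = (fun y => t + y) '' (K : Set (Euc d)) → φ L = φ K
  continuous : Continuous φ
  homogeneous : ∀ (K : ConvexBody (Euc d)) (c : ℝ), 0 < c → φ (c • K) = c ^ j * φ K

/-- The closed segment with endpoints `0` and `x`, as a convex body. -/
def segBody {d : ℕ} (x : Euc d) : ConvexBody (Euc d) where
  carrier := segment ℝ 0 x
  convex' := convex_segment 0 x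
  isCompact' := by
    rw [segment_eq_image]
    exact isCompact_Icc.image (by fun_prop)
  nonempty' := ⟨0, left_mem_segment ℝ 0 x⟩

/-- The kernel `h(x_1, …, x_j) = φ([0,x_1] + ⋯ + [0,x_j])` (Minkowski sum). -/
def kernelH {d j : ℕ} (φ : ConvexBody (Euc d) → ℝ) (x : Fin j → Euc d) : ℝ :=
  φ (∑ i, segBody (x i))

variable {Ω : Type*} [MeasurableSpace Ω]

/-- `θ = 𝔼 h(X_1, …, X_j)`. -/
def thetaH {d j : ℕ} (φ : ConvexBody (Euc d) → ℝ) (Y : Fin j → Ω → Euc d) (μ : Measure Ω) : ℝ :=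
  ∫ ω, kernelH φ (fun i => Y i ω) ∂μ

/-- `h_1(x) = 𝔼 h(x, X_2, …, X_j)`: the first argument is replaced by the fixed vector `x`. -/
def kernelH1 {d j : ℕ} [NeZero j] (φ : ConvexBody (Euc d) → ℝ) (Y : Fin j → Ω → Euc d)
    (μ : Measure Ω) (x : Euc d) : ℝ :=
  ∫ ω, kernelH φ (Function.update (fun i => Y i ω) 0 x) ∂μ

/-- `ζ_1 = 𝔼 (h_1(X_1) - θ)^2`, as an element of `[0, ∞]`. -/
def zeta1 {d j : ℕ} [NeZero j] (φ : ConvexBody (Euc d) → ℝ) (Y : Fin j → Ω → Euc d)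
    (μ : Measure Ω) : ℝ≥0∞ :=
  ∫⁻ ω, ENNReal.ofReal ((kernelH1 φ Y μ (Y 0 ω) - thetaH φ Y μ) ^ 2) ∂μ

end

/-!
The kernel `h(x₁, …, x_j) = φ([0, x₁] + ⋯ + [0, x_j])` is positively homogeneous of degree one in
each argument. Indeed the valuation property, applied to the two halves into which `K + {a x}` cuts
`K + [0, (a + b) x]`, shows that `a ↦ φ (K + [0, a x]) - φ K` is additive on `[0, ∞)`, hence linear
by continuity (`IsVal.add_segBody_smul`). Comparing with homogeneity of degree `j`, `φ` vanishes on
sums of fewer than `j` segments (`IsVal.sum_segBody_eq_zero`), so `h` is linear under nonnegative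
rescaling of each argument (`IsVal.kernelH_smul`). By compactness `|h(x)| ≤ C ∏ ‖x_i‖`
(`IsVal.exists_abs_kernelH_le`). Independence then gives integrability and `|h₁(x)| ≤ D ‖x‖`, which
also settles the finiteness of `ζ₁` under a second moment.

If `ζ₁ = 0`, then `h₁(X) = θ` almost surely. Since `o` is in the support of `X`, the bound on `h₁`
forces `θ = 0` (`eq_zero_of_ae_eq_const`). But `φ` has constant sign: the segment of bodies
`(1 - t) K + t L` towards a body `L` of dimension at least `j` stays, for `t > 0`, among the bodies
on which `φ` has no zero (`IsVal.nonneg_or_nonpos`). The support of `X` contains `j` linearly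
independent points, near which `h` does not vanish, so `θ ≠ 0` (`integral_pi_ne_zero`), a
contradiction.
-/

open Filter Topology

/-! ### Continuity of the operations on convex bodies -/

namespace ConvexBody

variable {V : Type*} [NormedAddCommGroup V] [NormedSpace ℝ V]

theorem exists_dist_le_dist (K L : ConvexBody V) {x : V} (hx : x ∈ K) :
    ∃ y ∈ L, dist x y ≤ dist K L := by
  obtain ⟨y, hy, h⟩ := L.isCompact.exists_infDist_eq_dist L.nonempty x
  exact ⟨y, hy, h ▸ Metric.infDist_le_hausdorffDist_of_mem hx hausdorffEDist_ne_top⟩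

theorem dist_add_add_le_add (K L K' L' : ConvexBody V) :
    dist (K + L) (K' + L') ≤ dist K K' + dist L L' := by
  have key : ∀ A B A' B' : ConvexBody V, ∀ x ∈ ((A + B : ConvexBody V) : Set V),
      ∃ y ∈ ((A' + B' : ConvexBody V) : Set V), dist x y ≤ dist A A' + dist B B' := by
    intro A B A' B' x hx
    obtain ⟨a, ha, b, hb, rfl⟩ := Set.mem_add.1 hx
    obtain ⟨a', ha', h1⟩ := exists_dist_le_dist A A' ha
    obtain ⟨b', hb', h2⟩ := exists_dist_le_dist B B' hb
    exact ⟨a' + b', Set.add_mem_add ha' hb', (dist_add_add_le _ _ _ _).trans (add_le_add h1 h2)⟩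
  refine Metric.hausdorffDist_le_of_mem_dist (by positivity) (key K L K' L') fun x hx => ?_
  obtain ⟨y, hy, h⟩ := key K' L' K L x hx
  exact ⟨y, hy, by rwa [dist_comm K, dist_comm L]⟩

instance : ContinuousAdd (ConvexBody V) where
  continuous_add := by
    rw [continuous_iff_continuousAt]
    rintro ⟨K, L⟩
    rw [ContinuousAt, tendsto_iff_dist_tendsto_zero]
    have h : Tendsto (fun p : ConvexBody V × ConvexBody V => dist p.1 K + dist p.2 L)
        (𝓝 (K, L)) (𝓝 (dist K K + dist L L)) :=
      ContinuousAt.tendsto (f := fun p : ConvexBody V × ConvexBody V => dist p.1 K + dist p.2 L)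
        (by fun_prop)
    rw [dist_self, dist_self, add_zero] at h
    exact squeeze_zero (fun _ => dist_nonneg) (fun p => dist_add_add_le_add p.1 p.2 K L) h

theorem continuous_smul_const (K : ConvexBody V) : Continuous fun c : ℝ => c • K := by
  obtain ⟨M, hM, hK⟩ := K.isBounded.exists_pos_norm_le
  refine LipschitzWith.continuous (K := ⟨M, hM.le⟩) (LipschitzWith.of_dist_le_mul fun a b => ?_)
  have key : ∀ a b : ℝ, ∀ x ∈ ((a • K : ConvexBody V) : Set V),
      ∃ y ∈ ((b • K : ConvexBody V) : Set V), dist x y ≤ M * dist a b := by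
    intro a b x hx
    obtain ⟨k, hk, rfl⟩ := Set.mem_smul_set.1 hx
    refine ⟨b • k, Set.smul_mem_smul_set hk, ?_⟩
    rw [dist_eq_norm, ← sub_smul, norm_smul, mul_comm, Real.dist_eq, Real.norm_eq_abs]
    exact mul_le_mul_of_nonneg_right (hK k hk) (abs_nonneg _)
  refine Metric.hausdorffDist_le_of_mem_dist (by positivity) (key a b) fun x hx => ?_
  obtain ⟨y, hy, h⟩ := key b a x hx
  exact ⟨y, hy, by rwa [dist_comm a b]⟩

end ConvexBody

/-! ### Segments and dimension -/

section Segments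

variable {d : ℕ}

theorem mem_segBody_iff {x y : Euc d} : y ∈ segBody x ↔ ∃ t ∈ Set.Icc (0 : ℝ) 1, t • x = y := by
  change y ∈ segment ℝ 0 x ↔ _
  rw [segment_eq_image]
  simp

theorem segBody_smul (c : ℝ) (x : Euc d) : segBody (c • x) = c • segBody x := by
  refine ConvexBody.ext (Set.ext fun y => ?_)
  rw [ConvexBody.coe_smul, Set.mem_smul_set]
  change y ∈ segBody (c • x) ↔ ∃ z ∈ segBody x, c • z = y
  simp only [mem_segBody_iff]
  constructor
  · rintro ⟨t, ht, rfl⟩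
    exact ⟨t • x, ⟨t, ht, rfl⟩, smul_comm _ _ _⟩
  · rintro ⟨_, ⟨t, ht, rfl⟩, rfl⟩
    exact ⟨t, ht, smul_comm _ _ _⟩

theorem continuous_segBody : Continuous (segBody : Euc d → ConvexBody (Euc d)) := by
  refine LipschitzWith.continuous (K := 1) (LipschitzWith.of_dist_le_mul fun x y => ?_)
  have key : ∀ x y : Euc d, ∀ z ∈ (segBody x : Set (Euc d)),
      ∃ w ∈ (segBody y : Set (Euc d)), dist z w ≤ (1 : NNReal) * dist x y := by
    intro x y z hz
    obtain ⟨t, ht, rfl⟩ := mem_segBody_iff.1 hz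
    refine ⟨t • y, mem_segBody_iff.2 ⟨t, ht, rfl⟩, ?_⟩
    rw [dist_smul₀, Real.norm_of_nonneg ht.1]
    exact mul_le_mul_of_nonneg_right ht.2 dist_nonneg
  refine Metric.hausdorffDist_le_of_mem_dist (by positivity) (key x y) fun z hz => ?_
  obtain ⟨w, hw, h⟩ := key y x z hz
  exact ⟨w, hw, by rwa [dist_comm x y]⟩

theorem zero_mem_sum_segBody {ι : Type*} (s : Finset ι) (x : ι → Euc d) :
    (0 : Euc d) ∈ ∑ i ∈ s, segBody (x i) := by
  classical
  induction s using Finset.induction_on with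
  | empty => exact Set.mem_singleton (0 : Euc d)
  | insert a s ha ih =>
    rw [Finset.sum_insert ha]
    exact Set.mem_add.2 ⟨0, mem_segBody_iff.2 ⟨0, by simp, by simp⟩, 0, ih, add_zero 0⟩

theorem mem_sum_segBody {ι : Type*} {s : Finset ι} (x : ι → Euc d) {i : ι} (hi : i ∈ s) :
    x i ∈ ∑ i ∈ s, segBody (x i) := by
  classical
  rw [← Finset.add_sum_erase s _ hi]
  exact Set.mem_add.2 ⟨x i, mem_segBody_iff.2 ⟨1, by simp, by simp⟩, 0,
    zero_mem_sum_segBody _ _, add_zero _⟩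

theorem le_bodyDim_sum_segBody {j : ℕ} {v : Fin j → Euc d} (hv : LinearIndependent ℝ v) :
    j ≤ bodyDim (∑ i, segBody (v i)) := by
  have h : Submodule.span ℝ (Set.range v) ≤
      vectorSpan ℝ ((∑ i, segBody (v i) : ConvexBody (Euc d)) : Set (Euc d)) := by
    rw [Submodule.span_le]
    rintro _ ⟨i, rfl⟩
    have := vsub_mem_vectorSpan ℝ (mem_sum_segBody v (Finset.mem_univ i))
      (zero_mem_sum_segBody Finset.univ v)
    simpa using this
  calc j = Module.finrank ℝ (Submodule.span ℝ (Set.range v)) := by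
        rw [finrank_span_eq_card hv, Fintype.card_fin]
    _ ≤ _ := Submodule.finrank_mono h

theorem bodyDim_le_bodyDim_add_smul (K L : ConvexBody (Euc d)) {t : ℝ} (ht : t ≠ 0) :
    bodyDim L ≤ bodyDim (K + t • L) := by
  refine Submodule.finrank_mono ?_
  obtain ⟨k, hk⟩ := K.nonempty
  rw [vectorSpan_def, Submodule.span_le]
  rintro _ ⟨a, ha, b, hb, rfl⟩
  have h := vsub_mem_vectorSpan ℝ
    (s := ((K + t • L : ConvexBody (Euc d)) : Set (Euc d)))
    (Set.add_mem_add hk (Set.smul_mem_smul_set ha)) (Set.add_mem_add hk (Set.smul_mem_smul_set hb))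
  have h2 := Submodule.smul_mem _ t⁻¹ h
  simpa [smul_sub, smul_smul, ht] using h2

end Segments

/-! ### Valuations on sums of segments -/

/-- A continuous additive function on `[0, ∞)` is linear. -/
theorem eq_mul_of_continuous_of_add {f : ℝ → ℝ} (hf : Continuous f)
    (hadd : ∀ a b, 0 ≤ a → 0 ≤ b → f (a + b) = f a + f b) {c : ℝ} (hc : 0 ≤ c) :
    f c = c * f 1 := by
  have f0 : f 0 = 0 := by simpa using hadd 0 0 le_rfl le_rfl
  -- The odd extension of `f` is additive on all of `ℝ`.
  let g : ℝ →+ ℝ :=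
    { toFun := fun a => f a⁺ - f a⁻
      map_zero' := by simp
      map_add' := fun a b => by
        have e : (a + b)⁺ + (a⁻ + b⁻) = (a + b)⁻ + (a⁺ + b⁺) := by
          have h1 := posPart_sub_negPart a
          have h2 := posPart_sub_negPart b
          have h3 := posPart_sub_negPart (a + b)
          linarith
        have := congrArg f e
        rw [hadd _ _ (posPart_nonneg _) (add_nonneg (negPart_nonneg _) (negPart_nonneg _)),
          hadd _ _ (negPart_nonneg _) (add_nonneg (posPart_nonneg _) (posPart_nonneg _)),
          hadd _ _ (negPart_nonneg _) (negPart_nonneg _),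
          hadd _ _ (posPart_nonneg _) (posPart_nonneg _)] at this
        linarith }
  have hg : Continuous g := by
    change Continuous fun a : ℝ => f a⁺ - f a⁻
    simp only [posPart_def, negPart_def]
    fun_prop
  have h := map_real_smul g hg c 1
  have h1 : ∀ a, 0 ≤ a → g a = f a := fun a ha => by
    change f a⁺ - f a⁻ = f a
    rw [posPart_eq_self.2 ha, negPart_eq_zero.2 ha, f0, sub_zero]
  simpa [h1 _ hc, h1 1 zero_le_one] using h

namespace IsVal

variable {d j : ℕ} {φ : ConvexBody (Euc d) → ℝ}

/-- The bodies `K + [0, a x]` and `K + [a x, (a + b) x]` have union `K + [0, (a + b) x]` and, by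
convexity of `K`, intersection `K + a x`. -/
theorem add_segBody_add (hφ : IsVal j φ) (K : ConvexBody (Euc d)) (x : Euc d) {a b : ℝ}
    (ha : 0 ≤ a) (hb : 0 ≤ b) :
    φ (K + segBody ((a + b) • x)) + φ K = φ (K + segBody (a • x)) + φ (K + segBody (b • x)) := by
  have hmem : ∀ {c : ℝ}, 0 ≤ c → ∀ y : Euc d, y ∈ ((K + segBody (c • x) : ConvexBody (Euc d)) :
      Set (Euc d)) ↔ ∃ k ∈ K, ∃ s : ℝ, 0 ≤ s ∧ s ≤ c ∧ k + s • x = y := by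
    intro c hc y
    rw [ConvexBody.coe_add, Set.mem_add]
    constructor
    · rintro ⟨k, hk, _, hz, rfl⟩
      obtain ⟨t, ht, rfl⟩ := mem_segBody_iff.1 hz
      exact ⟨k, hk, t * c, mul_nonneg ht.1 hc, mul_le_of_le_one_left hc ht.2, by rw [smul_smul]⟩
    · rintro ⟨k, hk, s, hs, hsc, rfl⟩
      refine ⟨k, hk, s • x, mem_segBody_iff.2 ?_, rfl⟩
      rcases hc.eq_or_lt with rfl | hc
      · exact ⟨0, by simp, by simp [le_antisymm hsc hs]⟩
      · exact ⟨s / c, ⟨by positivity, (div_le_one hc).2 hsc⟩, by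
          rw [smul_smul, div_mul_cancel₀ _ hc.ne']⟩
  let T : Euc d → ConvexBody (Euc d) → ConvexBody (Euc d) := fun t L =>
    ⟨(fun y => t + y) '' (L : Set (Euc d)), by simpa using L.convex.translate t,
      L.isCompact.image (by fun_prop), L.nonempty.image _⟩
  have hT : ∀ t L, φ (T t L) = φ L := fun t L => hφ.translation_invariant L (T t L) t rfl
  rw [← hT (a • x) K, ← hT (a • x) (K + segBody (b • x))]
  apply hφ.valuation
  · ext y
    rw [hmem (add_nonneg ha hb), Set.mem_union, hmem ha]
    constructor
    · rintro ⟨k, hk, s, hs, hsc, rfl⟩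
      rcases le_total s a with h | h
      · exact Or.inl ⟨k, hk, s, hs, h, rfl⟩
      · refine Or.inr ⟨k + (s - a) • x, (hmem hb _).2 ⟨k, hk, s - a, by linarith, by linarith, rfl⟩,
          ?_⟩
        dsimp only
        module
    · rintro (⟨k, hk, s, hs, hsc, rfl⟩ | ⟨z, hz, rfl⟩)
      · exact ⟨k, hk, s, hs, by linarith, rfl⟩
      · obtain ⟨k, hk, s, hs, hsc, rfl⟩ := (hmem hb z).1 hz
        refine ⟨k, hk, s + a, by linarith, by linarith, ?_⟩
        dsimp only
        module
  · ext y
    rw [Set.mem_inter_iff, hmem ha]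
    constructor
    · rintro ⟨k, hk, rfl⟩
      refine ⟨⟨k, hk, a, ha, le_rfl, add_comm _ _⟩, k, (hmem hb k).2 ⟨k, hk, 0, le_rfl, hb, ?_⟩, rfl⟩
      simp
    · rintro ⟨⟨k, hk, s, hs, hsa, rfl⟩, z, hz, hzy⟩
      obtain ⟨k', hk', s', hs', hsb', rfl⟩ := (hmem hb z).1 hz
      dsimp only at hzy
      -- `k + s x = k' + (a + s') x` with `s ≤ a ≤ a + s'`, so `k + s x - a x` lies between
      -- `k` and `k'`.
      refine ⟨k + (s - a) • x, ?_, by dsimp only; module⟩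
      have hk2 : k = k' + (a + s' - s) • x := by
        have : k = a • x + (k' + s' • x) - s • x := by rw [hzy]; abel
        rw [this]; module
      rcases eq_or_lt_of_le (show (0 : ℝ) ≤ a + s' - s by linarith) with h0 | h0
      · have : s - a = 0 := by linarith
        simpa [this] using hk
      · have := K.convex hk hk' (a := s' / (a + s' - s)) (b := (a - s) / (a + s' - s))
          (by positivity) (div_nonneg (by linarith) h0.le) (by field_simp; ring)
        convert! this using 1
        have e1 : s' / (a + s' - s) + (a - s) / (a + s' - s) = 1 := by field_simp; ring
        have e2 : s' / (a + s' - s) * (a + s' - s) = s' := by field_simp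
        rw [hk2]
        match_scalars
        · linarith
        · linarith

theorem add_segBody_smul (hφ : IsVal j φ) (K : ConvexBody (Euc d)) (x : Euc d) {c : ℝ}
    (hc : 0 ≤ c) :
    φ (K + segBody (c • x)) - φ K = c * (φ (K + segBody x) - φ K) := by
  have hcont : Continuous fun a : ℝ => φ (K + segBody (a • x)) - φ K :=
    (hφ.continuous.comp (continuous_const.add
      (continuous_segBody.comp (continuous_id.smul continuous_const)))).sub continuous_const
  have := eq_mul_of_continuous_of_add hcont (fun a b ha hb => by
    have := hφ.add_segBody_add K x ha hb
    linarith) hc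
  simpa using this

/-- If `φ` vanishes on sums over proper subsets of `s`, then it is linear under nonnegative
rescaling of each of the segments indexed by `s`. -/
theorem sum_segBody_smul (hφ : IsVal j φ) {ι : Type*} (s : Finset ι)
    (hs : ∀ t ⊂ s, ∀ x : ι → Euc d, φ (∑ i ∈ t, segBody (x i)) = 0)
    (c : ι → ℝ) (hc : ∀ i, 0 ≤ c i) (x : ι → Euc d) :
    φ (∑ i ∈ s, segBody (c i • x i)) = (∏ i ∈ s, c i) * φ (∑ i ∈ s, segBody (x i)) := by
  classical
  suffices H : ∀ u ⊆ s, φ (∑ i ∈ s, segBody (if i ∈ u then c i • x i else x i)) =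
      (∏ i ∈ u, c i) * φ (∑ i ∈ s, segBody (x i)) by
    rw [← H s subset_rfl]
    exact congrArg φ (Finset.sum_congr rfl fun i hi => by rw [if_pos hi])
  intro u
  induction u using Finset.induction_on with
  | empty => intro _; simp
  | insert a u ha ih =>
    intro hu
    have has : a ∈ s := hu (Finset.mem_insert_self a u)
    rw [Finset.prod_insert ha, mul_assoc, ← ih ((Finset.subset_insert a u).trans hu),
      ← Finset.sum_erase_add s _ has, ← Finset.sum_erase_add s _ has]
    have e : ∑ i ∈ s.erase a, segBody (if i ∈ insert a u then c i • x i else x i) =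
        ∑ i ∈ s.erase a, segBody (if i ∈ u then c i • x i else x i) :=
      Finset.sum_congr rfl fun i hi => by
        simp only [Finset.mem_insert, Finset.ne_of_mem_erase hi, false_or]
    rw [e, if_pos (Finset.mem_insert_self a u), if_neg ha]
    have h := hφ.add_segBody_smul
      (∑ i ∈ s.erase a, segBody (if i ∈ u then c i • x i else x i)) (x a) (hc a)
    rwa [hs _ (Finset.erase_ssubset has) (fun i => if i ∈ u then c i • x i else x i), sub_zero,
      sub_zero] at h

/-- Doubling a sum of `m < j` segments multiplies `φ` by `2 ^ j` by homogeneity, and by `2 ^ m` by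
linearity in each segment. -/
theorem sum_segBody_eq_zero (hφ : IsVal j φ) {ι : Type*} (s : Finset ι) (hs : s.card < j)
    (x : ι → Euc d) : φ (∑ i ∈ s, segBody (x i)) = 0 := by
  induction s using Finset.strongInduction generalizing x with
  | H s ih =>
    have h := hφ.sum_segBody_smul s (fun t ht y => ih t ht ((Finset.card_lt_card ht).trans hs) y)
      (fun _ => 2) (fun _ => zero_le_two) x
    simp only [segBody_smul, ← Finset.smul_sum, Finset.prod_const] at h
    rw [hφ.homogeneous _ _ zero_lt_two] at h
    have hlt : (2 : ℝ) ^ s.card < 2 ^ j := pow_lt_pow_right₀ one_lt_two hs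
    by_contra hne
    exact hlt.ne' (mul_right_cancel₀ hne h)

theorem kernelH_smul (hφ : IsVal j φ) {c : Fin j → ℝ} (hc : ∀ i, 0 ≤ c i) (x : Fin j → Euc d) :
    kernelH φ (fun i => c i • x i) = (∏ i, c i) * kernelH φ x :=
  hφ.sum_segBody_smul Finset.univ
    (fun t ht y => hφ.sum_segBody_eq_zero t (by simpa using Finset.card_lt_card ht) y) c hc x

theorem continuous_kernelH (hφ : IsVal j φ) :
    Continuous (kernelH φ : (Fin j → Euc d) → ℝ) :=
  hφ.continuous.comp
    (continuous_finsetSum _ fun i _ => continuous_segBody.comp (continuous_apply i))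

theorem exists_abs_kernelH_le (hφ : IsVal j φ) :
    ∃ C, ∀ x : Fin j → Euc d, |kernelH φ x| ≤ C * ∏ i, ‖x i‖ := by
  obtain ⟨C, hC⟩ := (isCompact_univ_pi fun _ : Fin j =>
    isCompact_closedBall (0 : Euc d) 1).exists_bound_of_continuousOn hφ.continuous_kernelH.continuousOn
  refine ⟨C, fun x => ?_⟩
  have h := hφ.kernelH_smul (c := fun i => ‖x i‖) (fun i => norm_nonneg _)
    (fun i => ‖x i‖⁻¹ • x i)
  have e : (fun i => ‖x i‖ • ‖x i‖⁻¹ • x i) = x := by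
    funext i
    by_cases hx : x i = 0
    · simp [hx]
    · rw [smul_smul, mul_inv_cancel₀ (norm_ne_zero_iff.2 hx), one_smul]
  rw [e] at h
  rw [h, abs_mul, abs_of_nonneg (Finset.prod_nonneg fun i _ => norm_nonneg (x i)), mul_comm]
  refine mul_le_mul_of_nonneg_right (hC _ ?_) (Finset.prod_nonneg fun i _ => norm_nonneg (x i))
  rw [Set.mem_univ_pi]
  intro i
  rw [mem_closedBall_zero_iff, norm_smul, norm_inv, norm_norm]
  exact inv_mul_le_one

/-- Along the path `(1 - t) K + t L` from `K` to a body `L` of dimension at least `j`, the dimension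
is at least `j` for `t > 0`, so `φ` has no zero there and keeps the sign of `φ L`. -/
theorem nonneg_of_pos (hφ : IsVal j φ) (hφ0 : ∀ K : ConvexBody (Euc d), j ≤ bodyDim K → φ K ≠ 0)
    {L : ConvexBody (Euc d)} (hL : j ≤ bodyDim L) (hpos : 0 < φ L) (K : ConvexBody (Euc d)) :
    0 ≤ φ K := by
  have hcont : Continuous fun t : ℝ => φ ((1 - t) • K + t • L) :=
    hφ.continuous.comp (((ConvexBody.continuous_smul_const K).comp
      (continuous_const.sub continuous_id)).add (ConvexBody.continuous_smul_const L))
  by_contra! hneg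
  have hL0 : (0 : ℝ) • L = 0 := ConvexBody.ext (by
    rw [ConvexBody.coe_smul, Set.zero_smul_set L.nonempty, ConvexBody.coe_zero])
  have hK0 : (0 : ℝ) • K = 0 := ConvexBody.ext (by
    rw [ConvexBody.coe_smul, Set.zero_smul_set K.nonempty, ConvexBody.coe_zero])
  obtain ⟨t, ht, h0⟩ := intermediate_value_Icc (zero_le_one (α := ℝ)) hcont.continuousOn
    (show (0 : ℝ) ∈ Set.Icc _ _ by simpa [hL0, hK0] using ⟨hneg.le, hpos.le⟩)
  dsimp only at h0
  rcases eq_or_ne t 0 with rfl | ht0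
  · simp only [sub_zero, one_smul, hL0, add_zero] at h0
    exact hneg.ne h0
  · exact hφ0 _ (hL.trans (bodyDim_le_bodyDim_add_smul _ L ht0)) h0

theorem neg (hφ : IsVal j φ) : IsVal j fun K => -φ K where
  valuation K L U I hU hI := by
    have := hφ.valuation K L U I hU hI
    linarith
  translation_invariant K L t h := by rw [hφ.translation_invariant K L t h]
  continuous := hφ.continuous.neg
  homogeneous K c hc := by rw [hφ.homogeneous K c hc, mul_neg]

theorem nonneg_or_nonpos (hφ : IsVal j φ)
    (hφ0 : ∀ K : ConvexBody (Euc d), j ≤ bodyDim K → φ K ≠ 0)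
    {L : ConvexBody (Euc d)} (hL : j ≤ bodyDim L) : (∀ K, 0 ≤ φ K) ∨ ∀ K, φ K ≤ 0 := by
  rcases (hφ0 L hL).lt_or_gt with h | h
  · exact Or.inr fun K => neg_nonneg.1 <|
      hφ.neg.nonneg_of_pos (fun K hK => neg_ne_zero.2 (hφ0 K hK)) hL (neg_pos.2 h) K
  · exact Or.inl (hφ.nonneg_of_pos hφ0 hL h)

end IsVal

/-! ### Linearly independent points of a set -/

/-- A set that lies in no subspace of dimension `j - 1` contains `j` linearly independent
vectors. -/
theorem exists_linearIndependent_of_not_subset {d j : ℕ} [NeZero j] (hjd : j ≤ d) {S : Set (Euc d)}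
    (hS : ∀ L : Submodule ℝ (Euc d), Module.finrank ℝ L + 1 = j → ¬ S ⊆ (L : Set (Euc d))) :
    ∃ v : Fin j → Euc d, LinearIndependent ℝ v ∧ ∀ i, v i ∈ S := by
  obtain ⟨b, hbS, hspan, hb⟩ := exists_linearIndependent ℝ S
  obtain ⟨B, -, hbB, hB, hBli⟩ := exists_linearIndepOn_id_extension (K := ℝ) hb (Set.subset_univ b)
  have hBfin : B.Finite := hBli.linearIndependent.setFinite
  lift B to Finset (Euc d) using hBfin
  have hbfin : b.Finite := B.finite_toSet.subset hbB
  lift b to Finset (Euc d) using hbfin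
  have hBcard : B.card = d := by
    have h := finrank_span_finset_eq_card hBli
    have htop : Submodule.span ℝ (B : Set (Euc d)) = ⊤ := top_le_iff.1 fun x _ => hB (Set.mem_univ x)
    rw [htop, finrank_top, finrank_euclideanSpace_fin] at h
    exact h.symm
  have hj : 1 ≤ j := NeZero.one_le
  rcases lt_or_ge b.card j with hlt | hge
  · obtain ⟨c, hbc, hcB, hc⟩ := Finset.exists_subsuperset_card_eq (Finset.coe_subset.1 hbB)
      (show b.card ≤ j - 1 by omega) (show j - 1 ≤ B.card by omega)
    refine absurd ?_ (hS (Submodule.span ℝ (c : Set (Euc d))) ?_)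
    · exact (Submodule.subset_span (R := ℝ)).trans
        (hspan ▸ Submodule.span_mono (Finset.coe_subset.2 hbc))
    · rw [finrank_span_finset_eq_card (hBli.mono (Finset.coe_subset.2 hcB)), hc]
      omega
  · obtain ⟨e⟩ : Nonempty (Fin j ↪ b) := by
      rw [Function.Embedding.nonempty_iff_card_le]
      simpa using hge
    exact ⟨fun i => e i, hb.comp e e.injective, fun i => hbS (e i).2⟩

/-! ### Kernels dominated by the product of the norms -/

section ProductKernel

variable {E : Type*} [NormedAddCommGroup E] {j : ℕ} {H : (Fin j → E) → ℝ} {C : ℝ}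

theorem abs_update_le [NeZero j] (hb : ∀ y, |H y| ≤ C * ∏ i, ‖y i‖) (x : E) (y : Fin j → E) :
    |H (Function.update y 0 x)| ≤ C * ‖x‖ * ∏ i ∈ Finset.univ.erase 0, ‖y i‖ := by
  refine (hb _).trans_eq ?_
  rw [← Finset.mul_prod_erase Finset.univ _ (Finset.mem_univ 0), Function.update_self, ← mul_assoc]
  exact congrArg _ (Finset.prod_congr rfl fun i hi => by
    rw [Function.update_of_ne (Finset.ne_of_mem_erase hi)])

variable [MeasurableSpace E] {ν : Measure E}

/-- A function that is `O(‖x‖)` and almost surely constant under a law whose support contains the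
origin has constant value `0`. -/
theorem eq_zero_of_ae_eq_const {f : E → ℝ} {D θ : ℝ} (hf : ∀ x, |f x| ≤ D * ‖x‖)
    (h0 : (0 : E) ∈ ν.support) (hae : ∀ᵐ x ∂ν, f x = θ) : θ = 0 := by
  by_contra hθ
  have hcont : Tendsto (fun x : E => D * ‖x‖) (𝓝 0) (𝓝 0) := by
    have : Continuous fun x : E => D * ‖x‖ := by fun_prop
    simpa using this.tendsto 0
  have hU : {x : E | D * ‖x‖ < |θ|} ∈ 𝓝 (0 : E) := hcont.eventually_lt_const (abs_pos.2 hθ)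
  have hpos := (Measure.mem_support_iff_forall (0 : E)).1 h0 _ hU
  refine hpos.ne' (measure_mono_null (fun x hx => ?_) hae)
  rintro rfl
  exact absurd (hf x) (not_le.2 hx)

variable [IsProbabilityMeasure ν]

theorem integrable_prod_erase_norm [NeZero j] (hν : Integrable (fun x : E => x) ν) :
    Integrable (fun y : Fin j → E => ∏ i ∈ Finset.univ.erase 0, ‖y i‖)
      (Measure.pi fun _ : Fin j => ν) := by
  have h := Integrable.fintype_prod (μ := fun _ : Fin j => ν)
    (f := fun (i : Fin j) (x : E) => if i = 0 then (1 : ℝ) else ‖x‖) (fun i => by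
      by_cases hi : i = 0
      · simp [hi]
      · simpa [hi] using hν.norm)
  convert h using 2 with y
  rw [← Finset.mul_prod_erase Finset.univ _ (Finset.mem_univ 0), if_pos rfl, one_mul]
  exact Finset.prod_congr rfl fun i hi => by rw [if_neg (Finset.ne_of_mem_erase hi)]

theorem exists_abs_integral_update_le [NeZero j] (hν : Integrable (fun x : E => x) ν)
    (hb : ∀ y, |H y| ≤ C * ∏ i, ‖y i‖) :
    ∃ D, ∀ x, |∫ y, H (Function.update y 0 x) ∂(Measure.pi fun _ : Fin j => ν)| ≤ D * ‖x‖ := by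
  refine ⟨C * ∫ y : Fin j → E, ∏ i ∈ Finset.univ.erase 0, ‖y i‖ ∂(Measure.pi fun _ => ν),
    fun x => ?_⟩
  have h := norm_integral_le_of_norm_le ((integrable_prod_erase_norm hν).const_mul (C * ‖x‖))
    (f := fun y => H (Function.update y 0 x)) (ae_of_all _ (abs_update_le hb x))
  rw [integral_const_mul, Real.norm_eq_abs] at h
  linarith

variable [SecondCountableTopology E]

theorem integral_pi_ne_zero (hint : Integrable H (Measure.pi fun _ : Fin j => ν))
    (hH : Continuous H) (hsign : (∀ y, 0 ≤ H y) ∨ ∀ y, H y ≤ 0) {v : Fin j → E}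
    (hv : ∀ i, v i ∈ ν.support) (hHv : H v ≠ 0) :
    ∫ y, H y ∂(Measure.pi fun _ : Fin j => ν) ≠ 0 := by
  -- A box around `v` on which `H` does not vanish has positive measure.
  have hpos : 0 < (Measure.pi fun _ : Fin j => ν) (Function.support H) := by
    have hU : Function.support H ∈ 𝓝 v := hH.isOpen_support.mem_nhds hHv
    rw [nhds_pi, Filter.mem_pi'] at hU
    obtain ⟨I, U, hUv, hsub⟩ := hU
    have hsub' : Set.univ.pi U ⊆ Function.support H :=
      (Set.pi_mono' (fun _ _ => subset_rfl) (Set.subset_univ _)).trans hsub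
    refine lt_of_lt_of_le ?_ (measure_mono hsub')
    rw [Measure.pi_pi, pos_iff_ne_zero, Finset.prod_ne_zero_iff]
    exact fun i _ => ((Measure.mem_support_iff_forall (v i)).1 (hv i) (U i) (hUv i)).ne'
  rcases hsign with h | h
  · exact ((integral_pos_iff_support_of_nonneg h hint).2 hpos).ne'
  · have := (integral_pos_iff_support_of_nonneg (f := fun y => -H y)
      (fun y => neg_nonneg.2 (h y)) hint.neg).2 (by simpa [Function.support_fun_neg] using hpos)
    rw [integral_neg] at this
    linarith

variable [BorelSpace E]

theorem integrable_pi_of_abs_le_prod_norm (hν : Integrable (fun x : E => x) ν)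
    (hH : Continuous H) (hb : ∀ y, |H y| ≤ C * ∏ i, ‖y i‖) :
    Integrable H (Measure.pi fun _ : Fin j => ν) :=
  ((Integrable.fintype_prod (fun _ : Fin j => hν.norm)).const_mul C).mono'
    hH.aestronglyMeasurable (ae_of_all _ hb)

theorem integrable_pi_update [NeZero j] (hν : Integrable (fun x : E => x) ν)
    (hH : Continuous H) (hb : ∀ y, |H y| ≤ C * ∏ i, ‖y i‖) (x : E) :
    Integrable (fun y => H (Function.update y 0 x)) (Measure.pi fun _ : Fin j => ν) :=
  ((integrable_prod_erase_norm hν).const_mul (C * ‖x‖)).mono'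
    (hH.comp (continuous_id.update 0 continuous_const)).aestronglyMeasurable
    (ae_of_all _ (abs_update_le hb x))

theorem stronglyMeasurable_integral_update [NeZero j] (hH : Continuous H) :
    StronglyMeasurable fun x => ∫ y, H (Function.update y 0 x) ∂(Measure.pi fun _ : Fin j => ν) := by
  have hc : Continuous fun p : E × (Fin j → E) => H (Function.update p.2 0 p.1) :=
    hH.comp (continuous_snd.update 0 continuous_fst)
  exact hc.stronglyMeasurable.integral_prod_right

end ProductKernel

/-! ### Positivity of the first variance component -/

theorem lemma4p1 {d j : ℕ} [NeZero j] (hjd : j ≤ d)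
    -- the random vector `X`, with finite first moment
    {Ω : Type*} [MeasurableSpace Ω] (P : Measure Ω) [IsProbabilityMeasure P]
    (X : Ω → Euc d) (hX : Integrable X P)
    -- i.i.d. copies `Y 0, …, Y (j - 1)` of `X`
    {Ω' : Type*} [MeasurableSpace Ω'] (P' : Measure Ω') [IsProbabilityMeasure P']
    (Y : Fin j → Ω' → Euc d) (hindep : iIndepFun Y P')
    (hident : ∀ i, IdentDistrib (Y i) X P' P)
    -- the support of the law of `X`
    (h0 : (0 : Euc d) ∈ (P.map X).support)
    (hsupp : ∀ L : Submodule ℝ (Euc d), Module.finrank ℝ L + 1 = j →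
      ¬ (P.map X).support ⊆ (L : Set (Euc d)))
    -- the valuation
    (φ : ConvexBody (Euc d) → ℝ) (hφ : IsVal j φ)
    (hφ0 : ∀ K : ConvexBody (Euc d), j ≤ bodyDim K → φ K ≠ 0) :
    -- the expectations defining `θ` and `h_1` exist
    Integrable (fun ω => kernelH φ (fun i => Y i ω)) P' ∧
    (∀ x : Euc d, Integrable (fun ω => kernelH φ (Function.update (fun i => Y i ω) 0 x)) P') ∧
    -- `ζ_1 > 0`
    0 < zeta1 φ Y P' ∧
    -- if the second moment of `X` is finite, `ζ_1` is a finite, strictly positive real number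
    (MemLp X 2 P →
      Integrable (fun ω => (kernelH1 φ Y P' (Y 0 ω) - thetaH φ Y P') ^ 2) P' ∧
      0 < ∫ ω, (kernelH1 φ Y P' (Y 0 ω) - thetaH φ Y P') ^ 2 ∂P') := by
  have hXm : AEMeasurable X P := hX.aemeasurable
  have hYm : ∀ i, AEMeasurable (Y i) P' := fun i => (hident i).aemeasurable_fst
  have hYm' : AEMeasurable (fun ω i => Y i ω) P' := aemeasurable_pi_iff.2 hYm
  have hprob : IsProbabilityMeasure (P.map X) := Measure.isProbabilityMeasure_map hXm
  have hν : Integrable (fun x : Euc d => x) (P.map X) :=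
    (integrable_map_measure aestronglyMeasurable_id hXm).2 hX
  have hlaw : P'.map (fun ω i => Y i ω) = Measure.pi fun _ : Fin j => P.map X := by
    rw [hindep.map_fun_eq_pi_map hYm]
    exact congrArg _ (funext fun i => (hident i).map_eq)
  have hH := hφ.continuous_kernelH
  obtain ⟨C, hb⟩ := hφ.exists_abs_kernelH_le
  have hHu : ∀ x : Euc d, Continuous fun y : Fin j → Euc d => kernelH φ (Function.update y 0 x) :=
    fun x => hH.comp (continuous_id.update 0 continuous_const)
  have hint := integrable_pi_of_abs_le_prod_norm hν hH hb
  have htheta : thetaH φ Y P' = ∫ y, kernelH φ y ∂(Measure.pi fun _ : Fin j => P.map X) := by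
    rw [← hlaw, integral_map hYm' hH.aestronglyMeasurable]
    rfl
  have hh1 : kernelH1 φ Y P' = fun x => ∫ y, kernelH φ (Function.update y 0 x)
      ∂(Measure.pi fun _ : Fin j => P.map X) := by
    funext x
    rw [← hlaw, integral_map hYm' (hHu x).aestronglyMeasurable]
    rfl
  obtain ⟨D, hD⟩ := exists_abs_integral_update_le hν hb
  have hmeas : StronglyMeasurable (kernelH1 φ Y P') := hh1 ▸ stronglyMeasurable_integral_update hH
  replace hD : ∀ x, |kernelH1 φ Y P' x| ≤ D * ‖x‖ := by rw [hh1]; exact hD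
  have hYmeas : AEStronglyMeasurable (fun ω => kernelH1 φ Y P' (Y 0 ω)) P' :=
    (hmeas.measurable.comp_aemeasurable (hYm 0)).aestronglyMeasurable
  have hzeta : 0 < zeta1 φ Y P' := by
    rw [pos_iff_ne_zero]
    intro hz
    rw [zeta1, lintegral_eq_zero_iff'
      ((hYmeas.aemeasurable.sub_const _).pow_const 2).ennreal_ofReal] at hz
    have hae : ∀ᵐ x ∂(P.map X), kernelH1 φ Y P' x = thetaH φ Y P' := by
      rw [← (hident 0).map_eq, ae_map_iff (hYm 0)
        (measurableSet_eq_fun hmeas.measurable measurable_const)]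
      filter_upwards [hz] with ω hω
      have h2 := ENNReal.ofReal_eq_zero.1 hω
      exact sub_eq_zero.1 (pow_eq_zero_iff two_ne_zero |>.1 (le_antisymm h2 (sq_nonneg _)))
    -- `θ = 0` by the bound on `h₁` near the origin, but `h` has constant sign and `h v ≠ 0`.
    obtain ⟨v, hv, hvS⟩ := exists_linearIndependent_of_not_subset hjd hsupp
    have hdim := le_bodyDim_sum_segBody hv
    refine integral_pi_ne_zero hint hH ?_ hvS (hφ0 _ hdim)
      (htheta ▸ eq_zero_of_ae_eq_const hD h0 hae)
    exact (hφ.nonneg_or_nonpos hφ0 hdim).imp (fun h y => h _) (fun h y => h _)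
  refine ⟨?_, fun x => ?_, hzeta, fun hX2 => ?_⟩
  · exact (integrable_map_measure hH.aestronglyMeasurable hYm').1 (hlaw ▸ hint)
  · exact (integrable_map_measure (hHu x).aestronglyMeasurable hYm').1
      (hlaw ▸ integrable_pi_update hν hH hb x)
  · have hY2 : MemLp (Y 0) 2 P' := (hident 0).memLp_iff.2 hX2
    have h1 : MemLp (fun ω => kernelH1 φ Y P' (Y 0 ω)) 2 P' :=
      hY2.of_le_mul hYmeas (ae_of_all _ fun ω => hD _)
    have hsq : Integrable (fun ω => (kernelH1 φ Y P' (Y 0 ω) - thetaH φ Y P') ^ 2) P' :=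
      (h1.sub (memLp_const _)).integrable_sq
    refine ⟨hsq, ?_⟩
    rw [zeta1, ← ofReal_integral_eq_lintegral_ofReal hsq (ae_of_all _ fun ω => sq_nonneg _)] at hzeta
    exact ENNReal.ofReal_pos.1 hzeta
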